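/- Let $G$ be a countable discrete group with a sofic approximation $\sigma_i\colon G\to \mathrm{Sym}(d_i)$, $i\in\mathbb N$; that is, with $u_n$ the uniform probability measure on $\{1,\dots,n\}$, $u_{d_i}(\{j:\sigma_i(g)\sigma_i(h)(j)=\sigma_i(gh)(j)\})\to 1$ for all $g,h\in G$ and $u_{d_i}(\{j:\sigma_i(g)(j)=j\})\to 0$ for all $g\neq e$. Definitions. Let $G$ act by homeomorphisms on a compact metrizable space $Z$. A continuous pseudometric $\rho$ on $Z$ is *dynamically generating* if for all $x\ne y$ in $Z$ there is $g\in G$ with $\rho(gx,gy)>0$. On $Z^n$ put $\rho_2(x,y)^2=\frac1n\sum_{j=1}^n\rho(x(j),y(j))^2$. For finite $F\subseteq G$, finite $L\subseteq C(Z)$, $\delta>0$ and a Borel probability measure $\mu$ on $Z$, let $$\mathrm{Map}(\rho,F,\delta,\sigma_i)=\{\phi\in Z^{d_i}:\rho_2(g\phi,\phi\circ\sigma_i(g))<\delta\ \text{ for all } g\in F\},$$ $$\mathrm{Map}_\mu(\rho,F,L,\delta,\sigma_i)=\Big\{\phi\in\mathrm{Map}(\rho,F,\delta,\sigma_i):\Big|\int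 f\,d\mu-\tfrac1{d_i}\sum_{j}f(\phi(j))\Big|<\delta\ \text{ for all } f\in L\Big\}.$$ Borel probability measures $\mu_i$ on $Z^{d_i}$ *locally and empirically converge* to $\mu$ (with respect to $\rho$) if for all such $F,L,\delta$ we have $\mu_i(\mathrm{Map}_\mu(\rho,F,L,\delta,\sigma_i))\to1$ and, for each $f\in L$, $u_{d_i}(\{j:|\int f\,d\mu-\int f(\phi(j))\,d\mu_i(\phi)|<\delta\})\to 1$. They *locally and doubly empirically converge* to $\mu$ if the measures $\mu_i\otimes\mu_i$ on $Z^{d_i}\times Z^{d_i}=(Z\times Z)^{d_i}$ locally and empirically converge to $\mu\otimes\mu$, with respect to a dynamically generating continuous pseudometric on $Z\times Z$ with the diagonal action. For a pseudometric $\theta$ on a set, $N_\varepsilon(A,\theta)$ denotes the largest cardinality of a subset of $A$ any two distinct points of which have $\theta$-distance $>\varepsilon$. Let $\pi\colon X\to Z$ be a continuous $G$-equivariant surjection of compact metrizable $G$-spaces, let $\mu$ be a $G$-invariant Borel probability measure on $X$, and let $\rho_X,\rho_Z$ be dynamically generating continuous pseudometrics on $X,Z$. With $\log 0=-\infty$,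 the topological and the measure-theoretic entropy of $Z$ in the presence of $X$ are $$h_{(\sigma_i)_i,\mathrm{top}}(Z:X,G)=\sup_{\varepsilon>0}\ \inf_{F,\delta}\ \limsup_{i\to\infty}\frac1{d_i}\log N_\varepsilon\big(\{\pi\circ\phi:\phi\in\mathrm{Map}(\rho_X,F,\delta,\sigma_i)\},\rho_{Z,2}\big),$$ $$h_{(\sigma_i)_i,\mu}(Z:X,G)=\sup_{\varepsilon>0}\ \inf_{F,L,\delta}\ \limsup_{i\to\infty}\frac1{d_i}\log N_\varepsilon\big(\{\pi\circ\phi:\phi\in\mathrm{Map}_\mu(\rho_X,F,L,\delta,\sigma_i)\},\rho_{Z,2}\big).$$ For $Z=X$, $\pi=\mathrm{id}$ and $\rho_Z=\rho_X$ these are the topological and the measure-theoretic sofic entropy of $G\curvearrowright X$. Theorem. Let $X$ be a compact metrizable group on which $G$ acts by continuous automorphisms, and let $m_X$ be its normalized Haar measure. Suppose that some sequence of Borel probability measures $\mu_i$ on $X^{d_i}$ locally and doubly empirically converges to $m_X$, with respect to some dynamically generating continuous pseudometric on $X\times X$. Then for every closed, normal, $G$-invariant subgroup $Y$ of $X$,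 $$h_{(\sigma_i)_i,\mathrm{top}}(X/Y:X,G)=h_{(\sigma_i)_i,m_X}(X/Y:X,G),$$ and in particular (the case $Y=\{1\}$) the topological and the measure-theoretic sofic entropy of $G\curvearrowright X$ agree. Both equalities hold for every choice of dynamically generating continuous pseudometrics, chosen independently on the two sides. -/

import Mathlib

open MeasureTheory Filter Topology

noncomputable section

namespace SoficEntropy

/-- `u_n(A)`: the uniform probability measure on `{1, …, n}` evaluated at `A`. -/
def unif (n : ℕ) (A : Set (Fin n)) : ℝ := (A.ncard : ℝ) / (n : ℝ)

/-- A sequence of maps `σ i : G → Sym(d i)` is a sofic approximation of `G`. -/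
structure IsSoficApproximation {G : Type*} [Group G] {d : ℕ → ℕ}
    (σ : (i : ℕ) → G → Equiv.Perm (Fin (d i))) : Prop where
  almost_action : ∀ g h : G,
    Tendsto (fun i => unif (d i) {j | σ i g (σ i h j) = σ i (g * h) j}) atTop (𝓝 1)
  almost_free : ∀ g : G, g ≠ 1 →
    Tendsto (fun i => unif (d i) {j | σ i g j = j}) atTop (𝓝 0)

/-- A (continuous) pseudometric `ρ` on the `G`-space `X` that is dynamically generating. -/
structure IsDynGenPseudometric (G : Type*) [Group G] {X : Type*} [TopologicalSpace X]
    [MulAction G X] (ρ : X → X → ℝ) : Prop where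
  self_zero : ∀ x, ρ x x = 0
  symm : ∀ x y, ρ x y = ρ y x
  triangle : ∀ x y z, ρ x z ≤ ρ x y + ρ y z
  cont : Continuous fun p : X × X => ρ p.1 p.2
  generating : ∀ x y, x ≠ y → ∃ g : G, 0 < ρ (g • x) (g • y)

/-- The `ℓ²`-type pseudometric `ρ₂` on `X^n`, normalized by the uniform measure. -/
def rho2 {X : Type*} (ρ : X → X → ℝ) {n : ℕ} (x y : Fin n → X) : ℝ :=
  Real.sqrt ((∑ j, ρ (x j) (y j) ^ 2) / (n : ℝ))

/-- The topological microstates `Map(ρ, F, δ, σ)`. -/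
def topMap {G : Type*} [Group G] {X : Type*} [MulAction G X] (ρ : X → X → ℝ)
    (F : Finset G) (δ : ℝ) {n : ℕ} (σ : G → Equiv.Perm (Fin n)) : Set (Fin n → X) :=
  {φ | ∀ g ∈ F, rho2 ρ (fun j => g • φ j) (fun j => φ (σ g j)) < δ}

/-- The measure-theoretic microstates `Map_μ(ρ, F, L, δ, σ)`: those topological microstates `φ`
whose empirical measure `φ_* u_n` lies in the weak-star neighbourhood of `μ` given by `L, δ`.
The integral of `f` against `φ_* u_n` is the average of the numbers `f (φ j)`. -/
def measMap {G : Type*} [Group G] {X : Type*} [TopologicalSpace X] [MeasurableSpace X]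
    [MulAction G X] (μ : Measure X) (ρ : X → X → ℝ) (F : Finset G) (L : Finset C(X, ℝ)) (δ : ℝ)
    {n : ℕ} (σ : G → Equiv.Perm (Fin n)) : Set (Fin n → X) :=
  {φ | φ ∈ topMap ρ F δ σ ∧ ∀ f ∈ L, |(∫ x, f x ∂μ) - (∑ j, f (φ j)) / (n : ℝ)| < δ}

/-- Local and empirical convergence of measures `μ i` on `X^(d i)` to the measure `μ` on `X`. -/
def LocallyEmpiricallyConverges {G : Type*} [Group G] {X : Type*} [TopologicalSpace X]
    [MeasurableSpace X] [MulAction G X] {d : ℕ → ℕ} (σ : (i : ℕ) → G → Equiv.Perm (Fin (d i)))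
    (ρ : X → X → ℝ) (μs : (i : ℕ) → Measure (Fin (d i) → X)) (μ : Measure X) : Prop :=
  ∀ (F : Finset G) (L : Finset C(X, ℝ)) (δ : ℝ), 0 < δ →
    Tendsto (fun i => μs i (measMap μ ρ F L δ (σ i))) atTop (𝓝 1) ∧
    ∀ f ∈ L, Tendsto (fun i => unif (d i)
      {j | |(∫ x, f x ∂μ) - ∫ φ, f (φ j) ∂(μs i)| < δ}) atTop (𝓝 1)

/-- The measure `μ ⊗ μ`, viewed on `(X × X)^n` instead of `X^n × X^n`. -/
def doubled {X : Type*} [MeasurableSpace X] {n : ℕ} (μ : Measure (Fin n → X)) :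
    Measure (Fin n → X × X) :=
  (μ.prod μ).map fun p j => (p.1 j, p.2 j)

/-- Local and doubly empirical convergence: `μ i ⊗ μ i` locally and empirically converges to
`μ ⊗ μ`, for the diagonal action of `G` on `X × X` with the pseudometric `ρ` on `X × X`. -/
def LocallyDoublyEmpiricallyConverges {G : Type*} [Group G] {X : Type*} [TopologicalSpace X]
    [MeasurableSpace X] [MulAction G X] {d : ℕ → ℕ} (σ : (i : ℕ) → G → Equiv.Perm (Fin (d i)))
    (ρ : X × X → X × X → ℝ) (μs : (i : ℕ) → Measure (Fin (d i) → X)) (μ : Measure X) : Prop :=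
  LocallyEmpiricallyConverges σ ρ (fun i => doubled (μs i)) (μ.prod μ)

/-- `N_ε(A, dist)`: the largest cardinality of an `ε`-separated subset of `A`. -/
def sepNumber {Z : Type*} (A : Set Z) (dist : Z → Z → ℝ) (ε : ℝ) : ℕ∞ :=
  ⨆ (S : Set Z) (_ : S ⊆ A ∧ ∀ a ∈ S, ∀ b ∈ S, a ≠ b → ε < dist a b), S.encard

/-- The exponential growth rate `limsup (1 / d i) log N_ε(A i, ρ₂)` for `A i ⊆ Z^(d i)`;
here `log 0 = -∞`. -/
def growthRate {Z : Type*} {d : ℕ → ℕ} (A : (i : ℕ) → Set (Fin (d i) → Z)) (ρ : Z → Z → ℝ)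
    (ε : ℝ) : EReal :=
  limsup (fun i => ENNReal.log (sepNumber (A i) (rho2 ρ) ε : ENNReal) / ((d i : ℝ) : EReal)) atTop

/-- Topological entropy of `Z` in the presence of `X`, for the factor map `π : X → Z`, computed
with the pseudometrics `ρX` on `X` and `ρZ` on `Z`. -/
def topEntropyInPresence {G : Type*} [Group G] {X Z : Type*} [MulAction G X] {d : ℕ → ℕ}
    (σ : (i : ℕ) → G → Equiv.Perm (Fin (d i))) (π : X → Z) (ρZ : Z → Z → ℝ) (ρX : X → X → ℝ) :
    EReal :=
  ⨆ (ε : ℝ) (_ : 0 < ε), ⨅ (F : Finset G) (δ : ℝ) (_ : 0 < δ),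
    growthRate (fun i => (fun φ => π ∘ φ) '' topMap ρX F δ (σ i)) ρZ ε

/-- Measure-theoretic entropy of `Z` in the presence of `X` for the invariant measure `μ` on `X`
and the factor map `π : X → Z`, computed with the pseudometrics `ρX` on `X` and `ρZ` on `Z`. -/
def measEntropyInPresence {G : Type*} [Group G] {X Z : Type*} [TopologicalSpace X]
    [MeasurableSpace X] [MulAction G X] {d : ℕ → ℕ}
    (σ : (i : ℕ) → G → Equiv.Perm (Fin (d i))) (μ : Measure X) (π : X → Z) (ρZ : Z → Z → ℝ)
    (ρX : X → X → ℝ) : EReal :=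
  ⨆ (ε : ℝ) (_ : 0 < ε), ⨅ (F : Finset G) (L : Finset C(X, ℝ)) (δ : ℝ) (_ : 0 < δ),
    growthRate (fun i => (fun φ => π ∘ φ) '' measMap μ ρX F L δ (σ i)) ρZ ε

/-- Topological sofic entropy of `X`: the case of the identity factor map. -/
def topEntropy {G : Type*} [Group G] {X : Type*} [MulAction G X] {d : ℕ → ℕ}
    (σ : (i : ℕ) → G → Equiv.Perm (Fin (d i))) (ρ : X → X → ℝ) : EReal :=
  topEntropyInPresence σ (id : X → X) ρ ρ

/-- Measure-theoretic sofic entropy of `(X, μ)`: the case of the identity factor map. -/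
def measEntropy {G : Type*} [Group G] {X : Type*} [TopologicalSpace X]
    [MeasurableSpace X] [MulAction G X] {d : ℕ → ℕ}
    (σ : (i : ℕ) → G → Equiv.Perm (Fin (d i))) (μ : Measure X) (ρ : X → X → ℝ) : EReal :=
  measEntropyInPresence σ μ (id : X → X) ρ ρ

/-- An action by automorphisms descends to the quotient by an invariant subgroup. -/
theorem quotientAction_of_invariant {G X : Type*} [Group G] [Group X] [MulDistribMulAction G X]
    {Y : Subgroup X} (hY : ∀ g : G, ∀ y ∈ Y, g • y ∈ Y) : MulAction.QuotientAction G Y :=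
  ⟨fun g a b h => by
    have := hY g _ h
    rwa [smul_mul', smul_inv'] at this⟩

end SoficEntropy

end

open SoficEntropy

/-!
The two entropies differ only in that measure-theoretic microstates must also have an empirical
measure close to `m`. One inequality is therefore a comparison of pseudometrics; the substance is
that, up to a factor `exp κ` with `κ > 0` arbitrary, there are as many separated measure-theoretic
microstates as topological ones.

Let `ψ` be sampled from `μ i`. For *every* `φ ∈ X^(d i)`, microstate or not, the empirical measure
of the pointwise product `φ * ψ` is close to `m` with high probability
(`LocallyDoublyEmpiricallyConverges.eventually_average_mul`). By compactness a continuous `f` has,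
up to a small error, only finitely many left translates, so
the average of `f (φ j * ψ j)` becomes a sum of finitely many averages of `c j * a (ψ j)`, where
`|c j| ≤ 1` and `a` is a translate of `f` minus its mean. As `m` is left invariant, `a` has mean
zero. By Cauchy–Schwarz the second moment of such an average is at most the square root of
the second moment of the overlap, the average of `a (ψ j) * a (ψ' j)` over two independent samples
(`sq_integral_sq_sum_le`), and double empirical convergence, tested on `a ⊗ a`, says that the
overlap tends to zero.

Multiplication `X × X → X` is continuous and equivariant, hence carries pairs of microstates to
microstates (`IsSoficApproximation.exists_topMap_comp`). So, given a separated family of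
topological microstates, a first moment argument (`exists_card_filter_ge`) yields one `ψ` that
translates nearly all of them to measure-theoretic microstates, and right translation by `ψ` keeps
them separated (`exists_separated_mul`). The fraction lost is a fixed small number, so that
no growth of `d i` is needed.

Independence of the pseudometrics rests on `IsDynGenPseudometric.exists_dominate`, which compares
any continuous function vanishing on coincidences with finitely many translates of a dynamically
generating pseudometric.
-/

namespace SoficEntropy

/-! ### Mean square distances -/

/-- The mean square distance of two points of `X^n`, that is, the square of `rho2`. -/
noncomputable def msd {X : Type*} (ρ : X → X → ℝ) {n : ℕ} (x y : Fin n → X) : ℝ :=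
  (∑ j, ρ (x j) (y j) ^ 2) / (n : ℝ)

section Msd

variable {X : Type*} {ρ : X → X → ℝ} {n : ℕ}

theorem rho2_lt_iff {δ : ℝ} (hδ : 0 < δ) (x y : Fin n → X) :
    rho2 ρ x y < δ ↔ msd ρ x y < δ ^ 2 :=
  Real.sqrt_lt' hδ

theorem lt_rho2_iff {δ : ℝ} (hδ : 0 < δ) (x y : Fin n → X) :
    δ < rho2 ρ x y ↔ δ ^ 2 < msd ρ x y :=
  Real.lt_sqrt hδ.le

theorem msd_symm (hs : ∀ x y, ρ x y = ρ y x) (x y : Fin n → X) : msd ρ x y = msd ρ y x := by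
  simp only [msd, hs]

theorem msd_comp_perm (x y : Fin n → X) (τ : Equiv.Perm (Fin n)) :
    msd ρ (fun j => x (τ j)) (fun j => y (τ j)) = msd ρ x y := by
  simp only [msd]
  rw [Equiv.sum_comp τ fun j => ρ (x j) (y j) ^ 2]

end Msd

/-- The averaged form of a pointwise domination. -/
theorem average_le_of_dominate {G X P : Type*} [Group G] [MulAction G X] {ρ : X → X → ℝ}
    {u v : P → X} {r : P → ℝ} {H : Finset G} {η C : ℝ}
    (hη : 0 ≤ η) (h : ∀ p, r p ≤ η + C * ∑ h ∈ H, ρ (h • u p) (h • v p) ^ 2) {n : ℕ}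
    (p : Fin n → P) :
    (∑ j, r (p j)) / (n : ℝ) ≤
      η + C * ∑ h ∈ H, msd ρ (fun j => h • u (p j)) (fun j => h • v (p j)) := by
  rcases Nat.eq_zero_or_pos n with rfl | hn
  · simpa [msd] using hη
  have hn' : (0 : ℝ) < n := by exact_mod_cast hn
  have h1 : ∑ j, r (p j) ≤ ∑ j, (η + C * ∑ h ∈ H, ρ (h • u (p j)) (h • v (p j)) ^ 2) :=
    Finset.sum_le_sum fun j _ => h (p j)
  rw [div_le_iff₀ hn']
  refine h1.trans_eq ?_
  rw [Finset.sum_add_distrib, ← Finset.mul_sum, Finset.sum_comm]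
  simp only [msd, ← Finset.sum_div, Finset.sum_const, Finset.card_univ, Fintype.card_fin,
    nsmul_eq_mul]
  field_simp

/-! ### Dynamically generating pseudometrics -/

section Metric

variable {G : Type*} [Group G] {X : Type*} [TopologicalSpace X] [MulAction G X] {ρ : X → X → ℝ}

theorem IsDynGenPseudometric.nonneg (hρ : IsDynGenPseudometric G ρ) (x y : X) : 0 ≤ ρ x y := by
  have h := hρ.triangle x y x
  rw [hρ.self_zero, hρ.symm y x] at h
  linarith

theorem IsDynGenPseudometric.sq_le (hρ : IsDynGenPseudometric G ρ) (x y z : X) :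
    ρ x z ^ 2 ≤ 2 * ρ x y ^ 2 + 2 * ρ y z ^ 2 := by
  have h1 := hρ.triangle x y z
  have h2 := hρ.nonneg x z
  nlinarith [sq_nonneg (ρ x y - ρ y z)]

theorem IsDynGenPseudometric.msd_le (hρ : IsDynGenPseudometric G ρ) {n : ℕ} (x y z : Fin n → X) :
    msd ρ x z ≤ 2 * msd ρ x y + 2 * msd ρ y z := by
  unfold msd
  rw [← mul_div_assoc, ← mul_div_assoc, ← add_div, Finset.mul_sum, Finset.mul_sum,
    ← Finset.sum_add_distrib]
  gcongr
  exact hρ.sq_le _ _ _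

theorem IsDynGenPseudometric.exists_bound [CompactSpace X] (hρ : IsDynGenPseudometric G ρ) :
    ∃ M : ℝ, 0 < M ∧ ∀ x y, ρ x y ^ 2 ≤ M := by
  obtain ⟨M, hM⟩ := (isCompact_range (hρ.cont.pow 2)).bddAbove
  refine ⟨max M 1, by positivity, fun x y => le_max_of_le_left (hM ⟨(x, y), rfl⟩)⟩

/-- A continuous function on a compact space that is nonpositive wherever `u` and `v` agree is
dominated, up to `η`, by finitely many translates of the dynamically generating `ρ`. -/
theorem IsDynGenPseudometric.exists_dominate [ContinuousConstSMul G X]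
    (hρ : IsDynGenPseudometric G ρ) {P : Type*} [TopologicalSpace P] [CompactSpace P]
    {u v : P → X} (hu : Continuous u) (hv : Continuous v) {r : P → ℝ} (hr : Continuous r)
    (h0 : ∀ p, u p = v p → r p ≤ 0) {η : ℝ} (hη : 0 < η) :
    ∃ (H : Finset G) (C : ℝ), 0 ≤ C ∧
      ∀ p, r p ≤ η + C * ∑ h ∈ H, ρ (h • u p) (h • v p) ^ 2 := by
  classical
  have hcont : ∀ g : G, Continuous fun p => ρ (g • u p) (g • v p) := fun g =>
    hρ.cont.comp ((hu.const_smul g).prodMk (hv.const_smul g))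
  have hK : IsCompact {p | η ≤ r p} := (isClosed_le continuous_const hr).isCompact
  obtain ⟨H, hH⟩ := hK.elim_finite_subcover (fun g : G => {p | 0 < ρ (g • u p) (g • v p)})
    (fun g => isOpen_lt continuous_const (hcont g)) (by
      intro p hp
      have hne : u p ≠ v p := fun h => by
        have := h0 p h
        have : η ≤ r p := hp
        linarith
      obtain ⟨g, hg⟩ := hρ.generating _ _ hne
      exact Set.mem_iUnion.2 ⟨g, hg⟩)
  set S : P → ℝ := fun p => ∑ h ∈ H, ρ (h • u p) (h • v p) ^ 2 with hS
  have hSc : Continuous S := continuous_finsetSum _ fun h _ => (hcont h).pow 2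
  have hS0 : ∀ p, 0 ≤ S p := fun p => Finset.sum_nonneg fun _ _ => sq_nonneg _
  have hSpos : ∀ p, η ≤ r p → 0 < S p := by
    intro p hp
    obtain ⟨g, hg, hgp⟩ := Set.mem_iUnion₂.1 (hH hp)
    exact Finset.sum_pos' (fun _ _ => sq_nonneg _) ⟨g, hg, pow_pos hgp 2⟩
  obtain ⟨M, hM⟩ := (isCompact_range hr).bddAbove
  rcases Set.eq_empty_or_nonempty {p | η ≤ r p} with he | hne
  · refine ⟨∅, 0, le_rfl, fun p => ?_⟩
    have : ¬ η ≤ r p := fun h => (he ▸ (show p ∈ {p | η ≤ r p} from h) : p ∈ (∅ : Set P))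
    simpa using (not_le.1 this).le
  · obtain ⟨p₀, hp₀, hmin⟩ := hK.exists_isMinOn hne hSc.continuousOn
    have hc := hSpos p₀ hp₀
    have hM0 : 0 ≤ M := hη.le.trans (le_trans hp₀ (hM ⟨p₀, rfl⟩))
    refine ⟨H, M / S p₀, by positivity, fun p => ?_⟩
    change r p ≤ η + M / S p₀ * S p
    by_cases hp : η ≤ r p
    · have h1 : S p₀ ≤ S p := hmin hp
      have h2 : M ≤ M / S p₀ * S p := by
        rw [div_mul_eq_mul_div, le_div_iff₀ hc]
        gcongr
      have h3 : r p ≤ M := hM ⟨p, rfl⟩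
      linarith
    · have : 0 ≤ M / S p₀ * S p := mul_nonneg (by positivity) (hS0 p)
      linarith [not_le.1 hp]

theorem isOpen_topMap [ContinuousConstSMul G X] (hρ : IsDynGenPseudometric G ρ) (F : Finset G)
    (δ : ℝ) {n : ℕ} (τ : G → Equiv.Perm (Fin n)) : IsOpen (topMap ρ F δ τ) := by
  have : topMap ρ F δ τ = ⋂ g ∈ F, {φ | rho2 ρ (fun j => g • φ j) (fun j => φ (τ g j)) < δ} := by
    ext φ; simp [topMap]
  rw [this]
  refine isOpen_biInter_finset fun g _ => isOpen_lt ?_ continuous_const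
  unfold rho2
  refine Real.continuous_sqrt.comp (Continuous.div_const (continuous_finsetSum _ fun j _ => ?_) _)
  have h : Continuous fun φ : Fin n → X => (g • φ j, φ (τ g j)) := by fun_prop
  exact (hρ.cont.comp h).pow 2

/-- The pseudometric `ρ (a, c) + ρ (b, d)` on pairs is dynamically generating. -/
theorem IsDynGenPseudometric.prod (hρ : IsDynGenPseudometric G ρ) :
    IsDynGenPseudometric G fun p q : X × X => ρ p.1 q.1 + ρ p.2 q.2 where
  self_zero p := by simp [hρ.self_zero]
  symm p q := by rw [hρ.symm p.1, hρ.symm p.2]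
  triangle p q r := by linarith [hρ.triangle p.1 q.1 r.1, hρ.triangle p.2 q.2 r.2]
  cont := by
    have h1 : Continuous fun p : (X × X) × (X × X) => (p.1.1, p.2.1) := by fun_prop
    have h2 : Continuous fun p : (X × X) × (X × X) => (p.1.2, p.2.2) := by fun_prop
    exact (hρ.cont.comp h1).add (hρ.cont.comp h2)
  generating p q hpq := by
    by_cases h : p.1 = q.1
    · have h2 : p.2 ≠ q.2 := fun h2 => hpq (Prod.ext h h2)
      obtain ⟨g, hg⟩ := hρ.generating _ _ h2
      exact ⟨g, add_pos_of_nonneg_of_pos (hρ.nonneg _ _) hg⟩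
    · obtain ⟨g, hg⟩ := hρ.generating _ _ h
      exact ⟨g, add_pos_of_pos_of_nonneg hg (hρ.nonneg _ _)⟩

end Metric

/-! ### Images of microstates under equivariant maps -/

section Sofic

variable {G : Type*} [Group G] {d : ℕ → ℕ} {σ : (i : ℕ) → G → Equiv.Perm (Fin (d i))}

/-- For `d i = 0` the junk value of `unif` is `0`, so this cannot happen infinitely often. -/
theorem IsSoficApproximation.eventually_pos (hσ : IsSoficApproximation σ) :
    ∀ᶠ i in atTop, 0 < d i := by
  filter_upwards [(hσ.almost_action 1 1).eventually (lt_mem_nhds zero_lt_one)] with i hi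
  by_contra h
  have h0 : d i = 0 := by omega
  simp [unif, h0] at hi

/-- Reindexing by `σ i (h * g)` or by `σ i h ∘ σ i g` makes little difference, uniformly over all
elements of `X^(d i)`. -/
theorem IsSoficApproximation.eventually_msd_lt (hσ : IsSoficApproximation σ) {X : Type*}
    {ρ : X → X → ℝ} (h0 : ∀ x, ρ x x = 0) {M : ℝ} (hM : ∀ x y, ρ x y ^ 2 ≤ M) (hM0 : 0 < M)
    (h g : G) {κ : ℝ} (hκ : 0 < κ) :
    ∀ᶠ i in atTop, ∀ φ : Fin (d i) → X,
      msd ρ (fun j => φ (σ i (h * g) j)) (fun j => φ (σ i h (σ i g j))) < κ := by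
  classical
  have hlt : 1 - κ / M < 1 := by have := div_pos hκ hM0; linarith
  filter_upwards [(hσ.almost_action h g).eventually (lt_mem_nhds hlt), hσ.eventually_pos]
    with i hi hd φ
  have hd' : (0 : ℝ) < d i := by exact_mod_cast hd
  set A : Finset (Fin (d i)) := Finset.univ.filter fun j => σ i h (σ i g j) = σ i (h * g) j with hA
  have hcard : ({j | σ i h (σ i g j) = σ i (h * g) j} : Set (Fin (d i))).ncard = A.card := by
    rw [← Set.ncard_coe_finset]; simp [hA]
  rw [unif, hcard, lt_div_iff₀ hd'] at hi
  have hc : (Aᶜ.card : ℝ) = d i - A.card := by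
    rw [Finset.card_compl, Nat.cast_sub (Finset.card_le_univ _), Fintype.card_fin]
  have hsum : ∑ j, ρ (φ (σ i (h * g) j)) (φ (σ i h (σ i g j))) ^ 2 ≤ Aᶜ.card * M := by
    rw [← Finset.sum_add_sum_compl A, Finset.sum_eq_zero, zero_add, ← nsmul_eq_mul]
    · exact Finset.sum_le_card_nsmul _ _ _ fun j _ => hM _ _
    · intro j hj
      rw [(Finset.mem_filter.1 hj).2, h0]
      simp
  rw [msd, div_lt_iff₀ hd']
  refine hsum.trans_lt ?_
  rw [hc]
  have h1 : M * ((1 - κ / M) * d i) < M * A.card := by gcongr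
  have h2 : M * ((1 - κ / M) * d i) = M * d i - κ * d i := by field_simp
  linarith

variable {X Z : Type*} [TopologicalSpace X] [TopologicalSpace Z] [MulAction G X] [MulAction G Z]
  [ContinuousConstSMul G X] [CompactSpace X]

/-- A continuous equivariant map sends good microstates to good microstates, whatever the
pseudometrics used on the two sides. -/
theorem IsSoficApproximation.exists_topMap_comp (hσ : IsSoficApproximation σ)
    {ρX : X → X → ℝ} (hX : IsDynGenPseudometric G ρX) {ρZ : Z → Z → ℝ}
    (hZ : IsDynGenPseudometric G ρZ) {π : X → Z} (hπ : Continuous π)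
    (hπG : ∀ (g : G) (x : X), π (g • x) = g • π x) (F : Finset G) {δ : ℝ} (hδ : 0 < δ) :
    ∃ (F' : Finset G) (δ' : ℝ), 0 < δ' ∧ ∀ᶠ i in atTop, ∀ φ ∈ topMap ρX F' δ' (σ i),
      (fun j => π (φ j)) ∈ topMap ρZ F δ (σ i) := by
  classical
  obtain ⟨H, C, hC, hdom⟩ := hX.exists_dominate (P := X × X) continuous_fst continuous_snd
    (r := fun p => ρZ (π p.1) (π p.2) ^ 2)
    ((hZ.cont.comp ((hπ.comp continuous_fst).prodMk (hπ.comp continuous_snd))).pow 2)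
    (fun p hp => by simp [hp, hZ.self_zero]) (η := δ ^ 2 / 2) (by positivity)
  obtain ⟨M, hM0, hM⟩ := hX.exists_bound
  -- The tolerance `t` is small enough for `htb`, where `10 t²` comes from two triangle
  -- inequalities between squares, each costing a factor `2`.
  set t : ℝ := δ / (6 * (C * H.card + 1)) with ht
  have hK : 0 ≤ C * (H.card : ℝ) := by positivity
  have ht0 : 0 < t := by positivity
  have htb : C * (H.card * (10 * t ^ 2)) < δ ^ 2 / 2 := by
    have h1 : t * (6 * (C * H.card + 1)) = δ := by rw [ht]; field_simp
    nlinarith [sq_nonneg (C * (H.card : ℝ) * t), mul_nonneg hK (sq_nonneg t), sq_pos_of_pos ht0]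
  refine ⟨H ∪ (H ×ˢ F).image fun p => p.1 * p.2, t, ht0, ?_⟩
  have hev : ∀ᶠ i in atTop, ∀ q ∈ H ×ˢ F, ∀ φ : Fin (d i) → X,
      msd ρX (fun j => φ (σ i (q.1 * q.2) j)) (fun j => φ (σ i q.1 (σ i q.2 j))) < t ^ 2 :=
    (Filter.eventually_all_finset _).2 fun q _ =>
      hσ.eventually_msd_lt hX.self_zero hM hM0 q.1 q.2 (by positivity)
  filter_upwards [hev] with i hi φ hφ g hg
  have hφ' : ∀ h ∈ H ∪ (H ×ˢ F).image fun p => p.1 * p.2,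
      msd ρX (fun j => h • φ j) (fun j => φ (σ i h j)) < t ^ 2 := fun h hh =>
    (rho2_lt_iff ht0 _ _).1 (hφ h hh)
  rw [rho2_lt_iff hδ]
  have h1 := average_le_of_dominate (by positivity) hdom fun j => (g • φ j, φ (σ i g j))
  simp only [hπG] at h1
  refine lt_of_le_of_lt h1 ?_
  have h2 : ∑ h ∈ H, msd ρX (fun j => h • g • φ j) (fun j => h • φ (σ i g j)) ≤
      H.card * (10 * t ^ 2) := by
    rw [← nsmul_eq_mul]
    refine Finset.sum_le_card_nsmul _ _ _ fun h hh => ?_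
    have e1 := hφ' (h * g) (Finset.mem_union_right _
      (Finset.mem_image.2 ⟨(h, g), Finset.mem_product.2 ⟨hh, hg⟩, rfl⟩))
    have e2 := hi (h, g) (Finset.mem_product.2 ⟨hh, hg⟩) φ
    have e3 := hφ' h (Finset.mem_union_left _ hh)
    have e4 := msd_comp_perm (ρ := ρX) (fun j => h • φ j) (fun j => φ (σ i h j)) (σ i g)
    have e5 := hX.msd_le (fun j => h • g • φ j) (fun j => φ (σ i (h * g) j))
      (fun j => h • φ (σ i g j))
    have e6 := hX.msd_le (fun j => φ (σ i (h * g) j)) (fun j => φ (σ i h (σ i g j)))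
      (fun j => h • φ (σ i g j))
    rw [msd_symm hX.symm] at e4
    simp only [mul_smul] at e1
    simp only at e2
    linarith
  have h3 := mul_le_mul_of_nonneg_left h2 hC
  linarith

end Sofic

/-! ### Separation under translation -/

section Separation

variable {G : Type*} [Group G] {Z : Type*} [TopologicalSpace Z] [MulAction G Z]
  [ContinuousConstSMul G Z] [CompactSpace Z] [Group Z] [IsTopologicalGroup Z]

/-- Separation survives a right translation and a change of the pseudometric, as long as the
translated points are good microstates. -/
theorem exists_separated_mul {ρ ρ' : Z → Z → ℝ} (hρ : IsDynGenPseudometric G ρ)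
    (hρ' : IsDynGenPseudometric G ρ') {ε : ℝ} (hε : 0 < ε) :
    ∃ (F : Finset G) (t : ℝ), 0 < t ∧ ∀ (n : ℕ) (τ : G → Equiv.Perm (Fin n)) (a b w : Fin n → Z),
      a * w ∈ topMap ρ' F t τ → b * w ∈ topMap ρ' F t τ → ε < rho2 ρ a b →
        t < rho2 ρ' (a * w) (b * w) := by
  -- The third coordinate is the translation, so that the comparison is uniform in it.
  obtain ⟨H, C, hC, hdom⟩ := hρ'.exists_dominate (P := Z × Z × Z)
    (u := fun p => p.1 * p.2.2) (v := fun p => p.2.1 * p.2.2) (r := fun p => ρ p.1 p.2.1 ^ 2)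
    (by fun_prop) (by fun_prop)
    ((hρ.cont.comp (continuous_fst.prodMk (continuous_fst.comp continuous_snd))).pow 2)
    (fun p hp => by simp [mul_right_cancel hp, hρ.self_zero]) (η := ε ^ 2 / 2) (by positivity)
  -- As above, `10 t²` comes from two triangle inequalities between squares.
  set t : ℝ := ε / (6 * (C * H.card + 1)) with ht
  have hK : 0 ≤ C * (H.card : ℝ) := by positivity
  have ht0 : 0 < t := by positivity
  have htb : C * (H.card * (10 * t ^ 2)) < ε ^ 2 / 2 := by
    have h1 : t * (6 * (C * H.card + 1)) = ε := by rw [ht]; field_simp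
    nlinarith [sq_nonneg (C * (H.card : ℝ) * t), mul_nonneg hK (sq_nonneg t), sq_pos_of_pos ht0]
  refine ⟨H, t, ht0, fun n τ a b w ha hb hab => ?_⟩
  rw [lt_rho2_iff hε] at hab
  rw [lt_rho2_iff ht0]
  by_contra! hcon
  have h1 := average_le_of_dominate (by positivity) hdom fun j => (a j, b j, w j)
  have h2 : ∑ h ∈ H, msd ρ' (fun j => h • (a j * w j)) (fun j => h • (b j * w j)) ≤
      H.card * (10 * t ^ 2) := by
    rw [← nsmul_eq_mul]
    refine Finset.sum_le_card_nsmul _ _ _ fun h hh => ?_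
    have e1 := (rho2_lt_iff ht0 _ _).1 (ha h hh)
    have e2 := (rho2_lt_iff ht0 _ _).1 (hb h hh)
    have e3 := msd_comp_perm (ρ := ρ') (a * w) (b * w) (τ h)
    have e4 := hρ'.msd_le (fun j => h • (a * w) j) (fun j => (a * w) (τ h j))
      (fun j => h • (b * w) j)
    have e5 := hρ'.msd_le (fun j => (a * w) (τ h j)) (fun j => (b * w) (τ h j))
      (fun j => h • (b * w) j)
    rw [msd_symm hρ'.symm] at e2
    simp only [Pi.mul_apply] at *
    have hcon' : msd ρ' (a * w) (b * w) ≤ t ^ 2 := hcon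
    linarith
  have h3 := mul_le_mul_of_nonneg_left h2 hC
  have h4 : msd ρ a b ≤ _ := h1
  linarith

end Separation

/-! ### Second moments and overlaps -/

section Moments

/-- The second moment of any combination of the `a j` with weights bounded by one is controlled by
the overlap `∑ j, a j ω * a j ω'` of two independent samples. -/
theorem sq_integral_sq_sum_le {Ω : Type*} [MeasurableSpace Ω] (μ : Measure Ω)
    [IsProbabilityMeasure μ] {n : ℕ} {a : Fin n → Ω → ℝ} (ha : ∀ j, Measurable (a j)) {M : ℝ}
    (hM : ∀ j ω, |a j ω| ≤ M) {c : Fin n → ℝ} (hc : ∀ j, |c j| ≤ 1) :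
    (∫ ω, (∑ j, c j * a j ω) ^ 2 ∂μ) ^ 2 ≤
      (n : ℝ) ^ 2 * ∫ p, (∑ j, a j p.1 * a j p.2) ^ 2 ∂(μ.prod μ) := by
  have hbd : ∀ j k ω, ‖a j ω * a k ω‖ ≤ M * M := fun j k ω => by
    rw [norm_mul]
    exact mul_le_mul (hM j ω) (hM k ω) (norm_nonneg _) ((abs_nonneg _).trans (hM j ω))
  have hint : ∀ j k, Integrable (fun ω => a j ω * a k ω) μ := fun j k =>
    Integrable.of_bound ((ha j).mul (ha k)).aestronglyMeasurable (M * M)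
      (Eventually.of_forall (hbd j k))
  set A : Fin n → Fin n → ℝ := fun j k => ∫ ω, a j ω * a k ω ∂μ with hA
  have hL : ∫ ω, (∑ j, c j * a j ω) ^ 2 ∂μ = ∑ j, ∑ k, c j * c k * A j k := by
    have : ∀ ω, (∑ j, c j * a j ω) ^ 2 = ∑ j, ∑ k, c j * c k * (a j ω * a k ω) := fun ω => by
      rw [sq, Finset.sum_mul_sum]
      exact Finset.sum_congr rfl fun j _ => Finset.sum_congr rfl fun k _ => by ring
    simp only [this]
    rw [integral_finsetSum _ fun j _ => integrable_finsetSum _ fun k _ => (hint j k).const_mul _]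
    refine Finset.sum_congr rfl fun j _ => ?_
    rw [integral_finsetSum _ fun k _ => (hint j k).const_mul _]
    exact Finset.sum_congr rfl fun k _ => integral_const_mul _ _
  have hR : ∫ p, (∑ j, a j p.1 * a j p.2) ^ 2 ∂(μ.prod μ) = ∑ j, ∑ k, A j k ^ 2 := by
    have : ∀ p : Ω × Ω, (∑ j, a j p.1 * a j p.2) ^ 2 =
        ∑ j, ∑ k, (a j p.1 * a k p.1) * (a j p.2 * a k p.2) := fun p => by
      rw [sq, Finset.sum_mul_sum]
      exact Finset.sum_congr rfl fun j _ => Finset.sum_congr rfl fun k _ => by ring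
    simp only [this]
    have hint2 : ∀ j k, Integrable (fun p : Ω × Ω => (a j p.1 * a k p.1) * (a j p.2 * a k p.2))
        (μ.prod μ) := fun j k => (hint j k).mul_prod (hint j k)
    rw [integral_finsetSum _ fun j _ => integrable_finsetSum _ fun k _ => hint2 j k]
    refine Finset.sum_congr rfl fun j _ => ?_
    rw [integral_finsetSum _ fun k _ => hint2 j k]
    refine Finset.sum_congr rfl fun k _ => ?_
    rw [integral_prod_mul (fun ω => a j ω * a k ω) (fun ω => a j ω * a k ω), sq]
  have h1 : |∑ j, ∑ k, c j * c k * A j k| ≤ ∑ q : Fin n × Fin n, |A q.1 q.2| := by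
    rw [← Fintype.sum_prod_type' fun j k => c j * c k * A j k]
    refine (Finset.abs_sum_le_sum_abs _ _).trans (Finset.sum_le_sum fun q _ => ?_)
    rw [abs_mul, abs_mul]
    have : |c q.1| * |c q.2| ≤ 1 := mul_le_one₀ (hc _) (abs_nonneg _) (hc _)
    exact mul_le_of_le_one_left (abs_nonneg _) this
  rw [hL, hR, ← sq_abs]
  calc |∑ j, ∑ k, c j * c k * A j k| ^ 2 ≤ (∑ q : Fin n × Fin n, |A q.1 q.2|) ^ 2 := by gcongr
    _ ≤ (Finset.univ : Finset (Fin n × Fin n)).card * ∑ q : Fin n × Fin n, |A q.1 q.2| ^ 2 :=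
        sq_sum_le_card_mul_sum_sq
    _ = (n : ℝ) ^ 2 * ∑ j, ∑ k, A j k ^ 2 := by
        simp only [sq_abs]
        rw [Finset.card_univ, Fintype.card_prod, Fintype.card_fin,
          ← Fintype.sum_prod_type' fun j k => A j k ^ 2]
        push_cast
        ring

theorem integral_sq_le_of_measure_abs_ge_le {Ω : Type*} [MeasurableSpace Ω] (ν : Measure Ω)
    [IsProbabilityMeasure ν] {f : Ω → ℝ} (hf : Measurable f) {K t s : ℝ}
    (hK : ∀ ω, |f ω| ≤ K) (hs : 0 ≤ s) (hE : ν {ω | t ≤ |f ω|} ≤ ENNReal.ofReal s) :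
    ∫ ω, f ω ^ 2 ∂ν ≤ t ^ 2 + K ^ 2 * s := by
  have hEm : MeasurableSet {ω | t ≤ |f ω|} := measurableSet_le measurable_const hf.abs
  have hb : ∀ ω, f ω ^ 2 ≤ t ^ 2 + {ω | t ≤ |f ω|}.indicator (fun _ => K ^ 2) ω := fun ω => by
    by_cases h : t ≤ |f ω|
    · rw [Set.indicator_of_mem (show ω ∈ {ω | t ≤ |f ω|} from h), ← sq_abs]
      have := pow_le_pow_left₀ (abs_nonneg _) (hK ω) 2
      nlinarith [sq_nonneg t]
    · rw [Set.indicator_of_notMem (show ω ∉ {ω | t ≤ |f ω|} from h), ← sq_abs, add_zero]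
      exact pow_le_pow_left₀ (abs_nonneg _) (not_le.1 h).le 2
  have hi1 : Integrable (fun ω => {ω | t ≤ |f ω|}.indicator (fun _ => K ^ 2) ω) ν :=
    (integrable_const _).indicator hEm
  have hi2 : Integrable (fun ω => f ω ^ 2) ν :=
    Integrable.of_bound (hf.pow_const 2).aestronglyMeasurable (K ^ 2) (Eventually.of_forall
      fun ω => by
        rw [norm_pow]
        exact pow_le_pow_left₀ (norm_nonneg _) (hK ω) 2)
  refine (integral_mono hi2 ((integrable_const _).add hi1) hb).trans ?_
  rw [Pi.add_def, integral_add (integrable_const _) hi1, integral_indicator_const _ hEm]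
  simp only [integral_const, probReal_univ, smul_eq_mul, one_mul]
  have : ν.real {ω | t ≤ |f ω|} ≤ s := ENNReal.toReal_le_of_le_ofReal hs hE
  nlinarith [sq_nonneg K]

end Moments

/-! ### Consequences of double empirical convergence -/

section Convergence

theorem tendsto_measure_of_eventually_subset {Ω : ℕ → Type*} [∀ i, MeasurableSpace (Ω i)]
    {ν : (i : ℕ) → Measure (Ω i)} [∀ i, IsProbabilityMeasure (ν i)] {A B : (i : ℕ) → Set (Ω i)}
    (hA : Tendsto (fun i => ν i (A i)) atTop (𝓝 1)) (hAB : ∀ᶠ i in atTop, A i ⊆ B i) :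
    Tendsto (fun i => ν i (B i)) atTop (𝓝 1) :=
  tendsto_of_tendsto_of_tendsto_of_le_of_le' hA tendsto_const_nhds
    (hAB.mono fun _ h => measure_mono h) (Eventually.of_forall fun _ => prob_le_one)

theorem eventually_measure_compl_le {Ω : ℕ → Type*} [∀ i, MeasurableSpace (Ω i)]
    {ν : (i : ℕ) → Measure (Ω i)} [∀ i, IsProbabilityMeasure (ν i)] {A : (i : ℕ) → Set (Ω i)}
    (hm : ∀ i, MeasurableSet (A i)) (hA : Tendsto (fun i => ν i (A i)) atTop (𝓝 1)) {s : ℝ}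
    (hs : 0 < s) : ∀ᶠ i in atTop, ν i (A i)ᶜ ≤ ENNReal.ofReal s := by
  have hlt : 1 - ENNReal.ofReal s < 1 :=
    ENNReal.sub_lt_self ENNReal.one_ne_top one_ne_zero (by simpa using hs)
  filter_upwards [hA.eventually (lt_mem_nhds hlt)] with i hi
  rw [prob_compl_eq_one_sub (hm i)]
  exact tsub_le_iff_tsub_le.1 hi.le

theorem measurable_pairing {X : Type*} [MeasurableSpace X] (n : ℕ) :
    Measurable fun (p : (Fin n → X) × (Fin n → X)) j => (p.1 j, p.2 j) :=
  measurable_pi_iff.2 fun j => by fun_prop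

instance isProbabilityMeasure_doubled {X : Type*} [MeasurableSpace X] {n : ℕ}
    (ν : Measure (Fin n → X)) [IsProbabilityMeasure ν] :
    IsProbabilityMeasure (doubled ν) :=
  Measure.isProbabilityMeasure_map (measurable_pairing n).aemeasurable

variable {G X : Type*} [Group G] [TopologicalSpace X] [CompactSpace X]
  [TopologicalSpace.MetrizableSpace X] [MeasurableSpace X] [BorelSpace X] [MulAction G X]
  {d : ℕ → ℕ} {σ : (i : ℕ) → G → Equiv.Perm (Fin (d i))}
  {μ : (i : ℕ) → Measure (Fin (d i) → X)} [∀ i, IsProbabilityMeasure (μ i)]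

/-- The points sampled from `μ i` are good microstates with high probability: project the
pairs sampled from the doubled measures to the first coordinate. -/
theorem LocallyDoublyEmpiricallyConverges.tendsto_topMap [ContinuousConstSMul G X]
    (hσ : IsSoficApproximation σ) {m : Measure X} {ρXX : X × X → X × X → ℝ}
    (hρXX : IsDynGenPseudometric G ρXX)
    (hμ : LocallyDoublyEmpiricallyConverges σ ρXX μ m) {ρ : X → X → ℝ}
    (hρ : IsDynGenPseudometric G ρ) (F : Finset G) {δ : ℝ} (hδ : 0 < δ) :
    Tendsto (fun i => μ i (topMap ρ F δ (σ i))) atTop (𝓝 1) := by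
  obtain ⟨F', δ', hδ', hev⟩ := hσ.exists_topMap_comp hρXX hρ (π := Prod.fst) continuous_fst
    (fun _ _ => rfl) F hδ
  have h1 := (hμ F' ∅ δ' hδ').1
  have h2 := tendsto_measure_of_eventually_subset
    (B := fun i => (fun χ : Fin (d i) → X × X => fun j => (χ j).1) ⁻¹' topMap ρ F δ (σ i)) h1
    (hev.mono fun i hi χ hχ => hi χ hχ.1)
  refine h2.congr fun i => ?_
  have hm : MeasurableSet (topMap ρ F δ (σ i)) := (isOpen_topMap hρ F δ (σ i)).measurableSet
  have hf : Measurable fun χ : Fin (d i) → X × X => fun j => (χ j).1 :=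
    measurable_pi_iff.2 fun j => by fun_prop
  rw [doubled, Measure.map_apply (measurable_pairing _) (hf hm)]
  have : (fun (p : (Fin (d i) → X) × (Fin (d i) → X)) j => (p.1 j, p.2 j)) ⁻¹'
      ((fun χ : Fin (d i) → X × X => fun j => (χ j).1) ⁻¹' topMap ρ F δ (σ i)) =
      topMap ρ F δ (σ i) ×ˢ Set.univ := by
    ext p; simp
  rw [this, Measure.prod_prod, measure_univ, mul_one]

/-- For `a` of mean zero, the overlap of two independent samples from `μ i` has second moment
tending to zero. -/
theorem LocallyDoublyEmpiricallyConverges.eventually_overlap_le {m : Measure X}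
    [IsProbabilityMeasure m] {ρXX : X × X → X × X → ℝ}
    (hμ : LocallyDoublyEmpiricallyConverges σ ρXX μ m) (a : C(X, ℝ)) (ha : ∫ x, a x ∂m = 0)
    {κ : ℝ} (hκ : 0 < κ) :
    ∀ᶠ i in atTop, ∫ p, ((∑ j, a (p.1 j) * a (p.2 j)) / (d i : ℝ)) ^ 2 ∂((μ i).prod (μ i)) ≤ κ := by
  classical
  obtain ⟨M, hM⟩ := (isCompact_range (map_continuous a).abs).bddAbove
  have hM' : ∀ x, |a x| ≤ M := fun x => hM ⟨x, rfl⟩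
  have hMM : ∀ x y, |a x * a y| ≤ M ^ 2 := fun x y => by
    rw [abs_mul, sq]
    exact mul_le_mul (hM' x) (hM' y) (abs_nonneg _) ((abs_nonneg _).trans (hM' x))
  let b : C(X × X, ℝ) := ⟨fun p => a p.1 * a p.2, by fun_prop⟩
  have hb : ∫ p, b p ∂(m.prod m) = 0 := by
    change ∫ p : X × X, a p.1 * a p.2 ∂(m.prod m) = 0
    rw [integral_prod_mul, ha, zero_mul]
  set t : ℝ := Real.sqrt (κ / 2) with ht
  have ht0 : 0 < t := Real.sqrt_pos.2 (by positivity)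
  have htsq : t ^ 2 = κ / 2 := Real.sq_sqrt (by positivity)
  set s : ℝ := κ / (2 * ((M ^ 2) ^ 2 + 1)) with hs
  have hs0 : 0 < s := by positivity
  have hss : (M ^ 2) ^ 2 * s ≤ κ / 2 := by
    have h1 : s * (2 * ((M ^ 2) ^ 2 + 1)) = κ := by rw [hs]; field_simp
    nlinarith
  let f : (i : ℕ) → (Fin (d i) → X) × (Fin (d i) → X) → ℝ := fun i p =>
    (∑ j, a (p.1 j) * a (p.2 j)) / (d i : ℝ)
  have ham : Measurable a := (map_continuous a).measurable
  have hfm : ∀ i, Measurable (f i) := fun i => by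
    refine Measurable.div_const (Finset.measurable_sum _ fun j _ => ?_) _
    exact (ham.comp (by fun_prop)).mul (ham.comp (by fun_prop))
  have hfK : ∀ i p, |f i p| ≤ M ^ 2 := fun i p => by
    rw [abs_div, Nat.abs_cast]
    refine div_le_of_le_mul₀ (Nat.cast_nonneg _) (sq_nonneg _) ?_
    refine (Finset.abs_sum_le_sum_abs _ _).trans ?_
    refine (Finset.sum_le_card_nsmul _ _ (M ^ 2) fun j _ => hMM _ _).trans_eq ?_
    simp [mul_comm]
  have hmeas : ∀ i, MeasurableSet {p | |f i p| < t} := fun i =>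
    measurableSet_lt (hfm i).abs measurable_const
  have h2 : Tendsto (fun i => ((μ i).prod (μ i)) {p | |f i p| < t}) atTop (𝓝 1) := by
    have hset : ∀ i, MeasurableSet
        {χ : Fin (d i) → X × X | |(∑ j, b (χ j)) / (d i : ℝ)| < t} := fun i => by
      refine measurableSet_lt (Measurable.abs (Measurable.div_const
        (Finset.measurable_sum _ fun j _ => ?_) _)) measurable_const
      change Measurable fun χ : Fin (d i) → X × X => a (χ j).1 * a (χ j).2
      exact (ham.comp (by fun_prop)).mul (ham.comp (by fun_prop))
    have h1 := tendsto_measure_of_eventually_subset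
      (B := fun i => {χ : Fin (d i) → X × X | |(∑ j, b (χ j)) / (d i : ℝ)| < t})
      (hμ ∅ {b} t ht0).1 (Eventually.of_forall fun i χ hχ => by
        have := hχ.2 b (Finset.mem_singleton_self b)
        rwa [hb, zero_sub, abs_neg] at this)
    refine h1.congr fun i => ?_
    rw [doubled, Measure.map_apply (measurable_pairing _) (hset i)]
    rfl
  filter_upwards [eventually_measure_compl_le hmeas h2 hs0] with i hi
  have hcompl : {p | |f i p| < t}ᶜ = {p | t ≤ |f i p|} := by ext p; simp
  rw [hcompl] at hi
  have := integral_sq_le_of_measure_abs_ge_le ((μ i).prod (μ i)) (hfm i) (hfK i) hs0.le hi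
  change ∫ p, f i p ^ 2 ∂((μ i).prod (μ i)) ≤ κ
  linarith

/-- For `a` of mean zero, weighted averages of `a` along a random sample are small with high
probability, uniformly over all weights bounded by one. -/
theorem LocallyDoublyEmpiricallyConverges.eventually_weighted_average {m : Measure X}
    [IsProbabilityMeasure m] {ρXX : X × X → X × X → ℝ} (hσ : IsSoficApproximation σ)
    (hμ : LocallyDoublyEmpiricallyConverges σ ρXX μ m) (a : C(X, ℝ)) (ha : ∫ x, a x ∂m = 0)
    {t κ : ℝ} (ht : 0 < t) (hκ : 0 < κ) :
    ∀ᶠ i in atTop, ∀ c : Fin (d i) → ℝ, (∀ j, |c j| ≤ 1) →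
      μ i {ψ | t ≤ |(∑ j, c j * a (ψ j)) / (d i : ℝ)|} ≤ ENNReal.ofReal κ := by
  obtain ⟨M, hM⟩ := (isCompact_range (map_continuous a).abs).bddAbove
  have hM' : ∀ x, |a x| ≤ M := fun x => hM ⟨x, rfl⟩
  have ham : Measurable a := (map_continuous a).measurable
  filter_upwards [hμ.eventually_overlap_le a ha (κ := (t ^ 2 * κ) ^ 2) (by positivity),
    hσ.eventually_pos] with i hi hd c hc
  have hd' : (0 : ℝ) < d i := by exact_mod_cast hd
  have h1 := sq_integral_sq_sum_le (μ i) (a := fun j ψ => a (ψ j))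
    (fun j => ham.comp (measurable_pi_apply j)) (fun j ψ => hM' (ψ j)) hc
  set f : (Fin (d i) → X) → ℝ := fun ψ => ((∑ j, c j * a (ψ j)) / (d i : ℝ)) ^ 2 with hf
  have hfc : Continuous f := by
    refine Continuous.pow (Continuous.div_const (continuous_finsetSum _ fun j _ => ?_) _) 2
    exact continuous_const.mul ((map_continuous a).comp (continuous_apply j))
  have hfi : Integrable f (μ i) := by
    obtain ⟨N, hN⟩ := (isCompact_range hfc.norm).bddAbove
    exact Integrable.of_bound hfc.measurable.aestronglyMeasurable N
      (Eventually.of_forall fun ψ => hN ⟨ψ, rfl⟩)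
  have h2 : ∫ ψ, f ψ ∂(μ i) ≤ t ^ 2 * κ := by
    refine le_of_sq_le_sq ?_ (by positivity)
    refine le_trans ?_ hi
    simp only [hf, div_pow, integral_div]
    rw [div_le_div_iff₀ (by positivity) (by positivity)]
    nlinarith [mul_le_mul_of_nonneg_right h1 (sq_nonneg (d i : ℝ))]
  have h3 := mul_meas_ge_le_integral_of_nonneg
    (Eventually.of_forall fun ψ => sq_nonneg _ : 0 ≤ᵐ[μ i] f) hfi (t ^ 2)
  have h4 : (μ i).real {ψ | t ^ 2 ≤ f ψ} ≤ κ :=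
    le_of_mul_le_mul_left (h3.trans h2) (by positivity)
  have h5 : {ψ : Fin (d i) → X | t ≤ |(∑ j, c j * a (ψ j)) / (d i : ℝ)|} ⊆ {ψ | t ^ 2 ≤ f ψ} := by
    intro ψ hψ
    change t ^ 2 ≤ ((∑ j, c j * a (ψ j)) / (d i : ℝ)) ^ 2
    rw [← sq_abs ((∑ j, c j * a (ψ j)) / (d i : ℝ))]
    exact pow_le_pow_left₀ ht.le hψ 2
  refine (measure_mono h5).trans ?_
  rw [← ofReal_measureReal]
  exact ENNReal.ofReal_le_ofReal h4

end Convergence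

/-! ### Translates of arbitrary points by random samples -/

section Haar

/-- Up to `η`, a continuous function on a compact group has only finitely many left translates. -/
theorem exists_finite_translates {X : Type*} [Group X] [TopologicalSpace X]
    [IsTopologicalGroup X] [CompactSpace X] (f : C(X, ℝ)) {η : ℝ} (hη : 0 < η) :
    ∃ t : Finset X, ∀ x, ∃ r ∈ t, ∀ y, |f (x * y) - f (r * y)| < η := by
  let Φ : C(X, C(X, ℝ)) := ContinuousMap.curry ⟨fun p : X × X => f (p.1 * p.2), by fun_prop⟩
  obtain ⟨t, -, ht⟩ := isCompact_univ.elim_nhds_subcover (fun x => {x' | dist (Φ x') (Φ x) < η})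
    (fun x _ => (isOpen_lt ((map_continuous Φ).dist continuous_const) continuous_const).mem_nhds
      (by simpa using hη))
  refine ⟨t, fun x => ?_⟩
  obtain ⟨r, hr, hxr⟩ := Set.mem_iUnion₂.1 (ht (Set.mem_univ x))
  exact ⟨r, hr, fun y => (ContinuousMap.dist_apply_le_dist y).trans_lt hxr⟩

variable {G X : Type*} [Group G] [Group X] [TopologicalSpace X] [IsTopologicalGroup X]
  [CompactSpace X]
  [TopologicalSpace.MetrizableSpace X] [MeasurableSpace X] [BorelSpace X] [MulAction G X]
  {d : ℕ → ℕ} {σ : (i : ℕ) → G → Equiv.Perm (Fin (d i))}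
  {μ : (i : ℕ) → Measure (Fin (d i) → X)} [∀ i, IsProbabilityMeasure (μ i)]

/-- Translating an arbitrary `φ` by a random sample makes its empirical measure close to the Haar
measure, with a probability of failure that is small uniformly in `φ`. -/
theorem LocallyDoublyEmpiricallyConverges.eventually_average_mul {m : Measure X}
    [IsProbabilityMeasure m] [m.IsMulLeftInvariant] {ρXX : X × X → X × X → ℝ}
    (hσ : IsSoficApproximation σ) (hμ : LocallyDoublyEmpiricallyConverges σ ρXX μ m) (f : C(X, ℝ))
    {δ κ : ℝ} (hδ : 0 < δ) (hκ : 0 < κ) :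
    ∀ᶠ i in atTop, ∀ φ : Fin (d i) → X,
      μ i {ψ | δ ≤ |(∫ x, f x ∂m) - (∑ j, f (φ j * ψ j)) / (d i : ℝ)|} ≤ ENNReal.ofReal κ := by
  classical
  obtain ⟨T, hT⟩ := exists_finite_translates f (half_pos hδ)
  choose r hrT hr using hT
  let a : X → C(X, ℝ) := fun x => ⟨fun y => f (x * y) - ∫ z, f z ∂m, by fun_prop⟩
  have hfi : ∀ g : C(X, ℝ), Integrable g m := fun g =>
    (map_continuous g).integrable_of_hasCompactSupport (HasCompactSupport.of_compactSpace g)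
  have ha : ∀ x, ∫ y, a x y ∂m = 0 := fun x => by
    change ∫ y, (f (x * y) - ∫ z, f z ∂m) ∂m = 0
    have h1 : Integrable (fun y => f (x * y)) m := hfi ⟨fun y => f (x * y), by fun_prop⟩
    rw [integral_sub h1 (integrable_const _), integral_mul_left_eq_self (fun y => f y) x]
    simp
  set N : ℝ := T.card + 1 with hN
  have hN0 : 0 < N := by positivity
  have hev : ∀ᶠ i in atTop, ∀ x ∈ T, ∀ c : Fin (d i) → ℝ, (∀ j, |c j| ≤ 1) →
      μ i {ψ | δ / 2 / N ≤ |(∑ j, c j * a x (ψ j)) / (d i : ℝ)|} ≤ ENNReal.ofReal (κ / N) :=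
    (Filter.eventually_all_finset _).2 fun x _ =>
      hμ.eventually_weighted_average hσ (a x) (ha x) (by positivity) (by positivity)
  filter_upwards [hev, hσ.eventually_pos] with i hi hd φ
  have hd' : (0 : ℝ) < d i := by exact_mod_cast hd
  -- The weights select the indices whose value `φ j` is approximated by the net point `x`.
  let c : X → Fin (d i) → ℝ := fun x j => if r (φ j) = x then 1 else 0
  have hc : ∀ x j, |c x j| ≤ 1 := fun x j => by
    by_cases h : r (φ j) = x <;> simp [c, h]
  have hsub : {ψ : Fin (d i) → X | δ ≤ |(∫ x, f x ∂m) - (∑ j, f (φ j * ψ j)) / (d i : ℝ)|} ⊆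
      ⋃ x ∈ T, {ψ | δ / 2 / N ≤ |(∑ j, c x j * a x (ψ j)) / (d i : ℝ)|} := by
    intro ψ hψ
    by_contra hnot
    simp only [Set.mem_iUnion, Set.mem_ofPred_eq, not_exists, not_le] at hnot
    have hsum : ∑ x ∈ T, ∑ j, c x j * a x (ψ j) = ∑ j, a (r (φ j)) (ψ j) := by
      rw [Finset.sum_comm]
      refine Finset.sum_congr rfl fun j _ => ?_
      rw [Finset.sum_eq_single_of_mem (r (φ j)) (hrT _)]
      · simp [c]
      · intro x _ hx
        simp [c, hx.symm]
    have h1 : |(∑ j, a (r (φ j)) (ψ j)) / (d i : ℝ)| ≤ δ / 2 := by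
      rw [← hsum, Finset.sum_div]
      refine (Finset.abs_sum_le_sum_abs _ _).trans
        ((Finset.sum_le_card_nsmul _ _ _ fun x hx => (hnot x hx).le).trans ?_)
      rw [nsmul_eq_mul, ← mul_div_assoc, div_le_iff₀ hN0]
      nlinarith
    have h2 : |(∑ j, f (φ j * ψ j)) / (d i : ℝ) - (∫ x, f x ∂m) -
        (∑ j, a (r (φ j)) (ψ j)) / (d i : ℝ)| < δ / 2 := by
      have : (∑ j, f (φ j * ψ j)) / (d i : ℝ) - (∫ x, f x ∂m) -
          (∑ j, a (r (φ j)) (ψ j)) / (d i : ℝ) =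
          (∑ j, (f (φ j * ψ j) - f (r (φ j) * ψ j))) / (d i : ℝ) := by
        simp only [a, ContinuousMap.coe_mk, Finset.sum_sub_distrib, Finset.sum_const,
          Finset.card_univ, Fintype.card_fin, nsmul_eq_mul]
        field_simp
        ring
      rw [this, abs_div, Nat.abs_cast, div_lt_iff₀ hd']
      refine (Finset.abs_sum_le_sum_abs _ _).trans_lt ?_
      have : ∑ j : Fin (d i), |f (φ j * ψ j) - f (r (φ j) * ψ j)| < ∑ _j : Fin (d i), δ / 2 :=
        Finset.sum_lt_sum_of_nonempty ⟨⟨0, hd⟩, Finset.mem_univ _⟩ fun j _ => hr _ _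
      refine this.trans_eq ?_
      simp [mul_comm]
    have h3 : δ ≤ |(∫ x, f x ∂m) - (∑ j, f (φ j * ψ j)) / (d i : ℝ)| := hψ
    rw [abs_sub_comm] at h3
    have h4 := abs_add_le ((∑ j, f (φ j * ψ j)) / (d i : ℝ) - (∫ x, f x ∂m) -
      (∑ j, a (r (φ j)) (ψ j)) / (d i : ℝ)) ((∑ j, a (r (φ j)) (ψ j)) / (d i : ℝ))
    rw [sub_add_cancel] at h4
    linarith
  refine (measure_mono hsub).trans ((measure_biUnion_finset_le _ _).trans ?_)
  refine (Finset.sum_le_card_nsmul _ _ _ fun x hx => hi x hx _ (hc x)).trans ?_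
  rw [nsmul_eq_mul, ← ENNReal.ofReal_natCast, ← ENNReal.ofReal_mul (Nat.cast_nonneg _)]
  refine ENNReal.ofReal_le_ofReal ?_
  rw [← mul_div_assoc, div_le_iff₀ hN0]
  nlinarith

end Haar

/-! ### Counting separated points -/

section Counting

/-- If each of finitely many events fails with probability at most `κ`, some point lies in all but
a fraction `κ` of them. -/
theorem exists_card_filter_ge {Ω ι : Type*} [MeasurableSpace Ω] (μ : Measure Ω)
    [IsProbabilityMeasure μ] (S : Finset ι) {B : ι → Set Ω} (hB : ∀ s, MeasurableSet (B s)) {κ : ℝ}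
    (hκ : 0 ≤ κ) (h : ∀ s ∈ S, μ (B s)ᶜ ≤ ENNReal.ofReal κ) :
    ∃ ω, ∃ T ⊆ S, (∀ s ∈ T, ω ∈ B s) ∧ (1 - κ) * S.card ≤ T.card := by
  classical
  have hi : ∀ s, Integrable ((B s).indicator fun _ => (1 : ℝ)) μ := fun s =>
    (integrable_const _).indicator (hB s)
  obtain ⟨ω, hω⟩ := exists_integral_le (μ := μ)
    (f := fun ω => ∑ s ∈ S, (B s).indicator (fun _ => (1 : ℝ)) ω)
    (integrable_finsetSum _ fun s _ => hi s)
  refine ⟨ω, S.filter fun s => ω ∈ B s, Finset.filter_subset _ _,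
    fun s hs => (Finset.mem_filter.1 hs).2, ?_⟩
  have h1 : ∑ s ∈ S, (B s).indicator (fun _ => (1 : ℝ)) ω = (S.filter fun s => ω ∈ B s).card := by
    simp [Set.indicator_apply]
  rw [h1] at hω
  refine le_trans ?_ hω
  rw [integral_finsetSum _ fun s _ => hi s, mul_comm, ← nsmul_eq_mul]
  refine Finset.card_nsmul_le_sum _ _ _ fun s hs => ?_
  rw [integral_indicator_const _ (hB s), smul_eq_mul, mul_one]
  have h2 : μ.real (B s)ᶜ ≤ κ := ENNReal.toReal_le_of_le_ofReal hκ (h s hs)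
  rw [probReal_compl_eq_one_sub (hB s)] at h2
  linarith

variable {Z : Type*} {dist dist' : Z → Z → ℝ} {A B : Set Z} {ε ε' : ℝ}

/-- Separation numbers, which may be infinite, can be bounded on finite separated sets. -/
theorem sepNumber_le_of_forall_finset {R : ENNReal}
    (h : ∀ S : Finset Z, (S : Set Z) ⊆ A → (∀ a ∈ S, ∀ b ∈ S, a ≠ b → ε < dist a b) →
      (S.card : ENNReal) ≤ R) :
    (sepNumber A dist ε : ENNReal) ≤ R := by
  rcases eq_or_ne R ⊤ with rfl | hR
  · exact le_top
  obtain ⟨n, hn⟩ : ∃ n : ℕ, ∀ k : ℕ, (k : ENNReal) ≤ R ↔ k ≤ n := by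
    refine ⟨⌊R.toReal⌋₊, fun k => ?_⟩
    rw [Nat.le_floor_iff ENNReal.toReal_nonneg, ← ENNReal.ofReal_natCast,
      ENNReal.ofReal_le_iff_le_toReal hR]
  have hle : sepNumber A dist ε ≤ (n : ℕ∞) := by
    refine iSup₂_le fun S hS => ?_
    by_contra! hlt
    obtain ⟨T, hTS, hT⟩ := Set.exists_subset_encard_eq (Order.add_one_le_of_lt hlt)
    have hfin : T.Finite := Set.finite_of_encard_eq_coe (k := n + 1) (by rw [hT]; rfl)
    have h1 := (hn _).1 (h hfin.toFinset (by simpa using hTS.trans hS.1) fun a ha b hb hab =>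
      hS.2 a (hTS (by simpa using ha)) b (hTS (by simpa using hb)) hab)
    have h2 : ((hfin.toFinset.card : ℕ) : ℕ∞) = n + 1 := by
      rw [← hT, hfin.encard_eq_coe_toFinset_card]
    have h3 : hfin.toFinset.card = n + 1 := by exact_mod_cast h2
    omega
  exact (ENat.toENNReal_mono hle).trans ((hn n).2 le_rfl)

theorem card_le_sepNumber (S : Finset Z) (hS : (S : Set Z) ⊆ A)
    (hsep : ∀ a ∈ S, ∀ b ∈ S, a ≠ b → ε < dist a b) :
    (S.card : ENNReal) ≤ (sepNumber A dist ε : ENNReal) := by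
  rw [← ENat.toENNReal_coe]
  refine ENat.toENNReal_mono ?_
  rw [← Set.encard_coe_eq_coe_finsetCard]
  exact le_iSup₂ (f := fun (S : Set Z)
    (_ : S ⊆ A ∧ ∀ a ∈ S, ∀ b ∈ S, a ≠ b → ε < dist a b) => S.encard) (S : Set Z) ⟨hS, hsep⟩

/-- A factor `exp κ` in the separation numbers costs at most `κ` in the growth rate, because
`d i ≥ 1`; nothing is assumed about `d i → ∞`. -/
theorem growthRate_le_add {d : ℕ → ℕ} (hd : ∀ᶠ i in atTop, 0 < d i)
    {A B : (i : ℕ) → Set (Fin (d i) → Z)} {κ : ℝ} (hκ : 0 ≤ κ)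
    (h : ∀ᶠ i in atTop, (sepNumber (A i) (rho2 dist) ε : ENNReal) ≤
      ENNReal.ofReal (Real.exp κ) * (sepNumber (B i) (rho2 dist') ε' : ENNReal)) :
    growthRate A dist ε ≤ growthRate B dist' ε' + (κ : EReal) := by
  have hc : limsup (fun _ : ℕ => (κ : EReal)) atTop = κ := limsup_const _
  refine (limsup_le_limsup ?_).trans ((EReal.limsup_add_le
    (u := fun i => ENNReal.log (sepNumber (B i) (rho2 dist') ε' : ENNReal) / ((d i : ℝ) : EReal))
    (v := fun _ => (κ : EReal))
    (Or.inr (by rw [hc]; exact EReal.coe_ne_top κ))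
    (Or.inr (by rw [hc]; exact EReal.coe_ne_bot κ))).trans_eq (by rw [hc]; rfl))
  filter_upwards [h, hd] with i hi hdi
  have hd1 : (1 : ℝ) ≤ d i := by exact_mod_cast hdi
  have hd0 : (0 : EReal) ≤ ((d i : ℝ) : EReal) := by exact_mod_cast (zero_le_one.trans hd1)
  refine (EReal.div_le_div_right_of_nonneg hd0 (ENNReal.log_le_log hi)).trans ?_
  rw [ENNReal.log_mul_add, ENNReal.log_ofReal_of_pos (Real.exp_pos _), Real.log_exp, add_comm,
    EReal.div_eq_inv_mul, EReal.left_distrib_of_nonneg_of_ne_top (EReal.inv_nonneg_of_nonneg hd0)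
      (by rw [← EReal.coe_inv]; exact EReal.coe_ne_top _), ← EReal.div_eq_inv_mul,
    ← EReal.div_eq_inv_mul, ← EReal.coe_div]
  exact add_le_add_right (EReal.coe_le_coe_iff.2 (div_le_self hκ hd1)) _

theorem le_of_forall_pos_le_add_coe {x y : EReal} (h : ∀ κ : ℝ, 0 < κ → x ≤ y + (κ : EReal)) :
    x ≤ y := by
  refine EReal.le_of_forall_lt_iff_le.1 fun z hz => ?_
  induction y with
  | bot => exact (h 1 one_pos).trans (by simp)
  | top => simp at hz
  | coe y =>
    have hyz : y < z := EReal.coe_lt_coe_iff.1 hz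
    refine (h (z - y) (sub_pos.2 hyz)).trans_eq ?_
    rw [← EReal.coe_add, add_sub_cancel]

end Counting

/-! ### Comparison of the entropies -/

section Entropy

variable {G X Z : Type*} [Group G]
  [Group X] [TopologicalSpace X] [CompactSpace X] [MulDistribMulAction G X]
  [ContinuousConstSMul G X] [TopologicalSpace Z] [MulAction G Z]
  {d : ℕ → ℕ} {σ : (i : ℕ) → G → Equiv.Perm (Fin (d i))}
  {ρX ρX' : X → X → ℝ} {ρZ ρZ' : Z → Z → ℝ}

/-- Pointwise products of good microstates, pushed forward by an equivariant map, are
good microstates. -/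
theorem IsSoficApproximation.exists_topMap_mul [IsTopologicalGroup X]
    (hσ : IsSoficApproximation σ) {π : X → Z} (hπ : Continuous π)
    (hπG : ∀ (g : G) (x : X), π (g • x) = g • π x)
    (hX : IsDynGenPseudometric G ρX) (hZ : IsDynGenPseudometric G ρZ) (F : Finset G) {δ : ℝ}
    (hδ : 0 < δ) :
    ∃ (F' : Finset G) (δ' : ℝ), 0 < δ' ∧ ∀ᶠ i in atTop, ∀ φ ∈ topMap ρX F' δ' (σ i),
      ∀ ψ ∈ topMap ρX F' δ' (σ i), (fun j => π (φ j * ψ j)) ∈ topMap ρZ F δ (σ i) := by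
  obtain ⟨F', δ', hδ', h⟩ := hσ.exists_topMap_comp hX.prod hZ (π := fun p : X × X => π (p.1 * p.2))
    (hπ.comp continuous_mul) (fun g p => by rw [← hπG, smul_mul']; rfl) F hδ
  refine ⟨F', δ' / 2, by positivity, h.mono fun i hi φ hφ ψ hψ => ?_⟩
  refine hi (fun j => (φ j, ψ j)) fun g hg => ?_
  have e1 := (rho2_lt_iff (half_pos hδ') _ _).1 (hφ g hg)
  have e2 := (rho2_lt_iff (half_pos hδ') _ _).1 (hψ g hg)
  rw [rho2_lt_iff hδ']
  have e3 : msd (fun p q : X × X => ρX p.1 q.1 + ρX p.2 q.2) (fun j => g • (φ j, ψ j))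
      (fun j => (φ (σ i g j), ψ (σ i g j))) ≤
      2 * msd ρX (fun j => g • φ j) (fun j => φ (σ i g j)) +
        2 * msd ρX (fun j => g • ψ j) (fun j => ψ (σ i g j)) := by
    unfold msd
    rw [← mul_div_assoc, ← mul_div_assoc, ← add_div, Finset.mul_sum, Finset.mul_sum,
      ← Finset.sum_add_distrib]
    gcongr with j
    simp only [Prod.smul_mk]
    nlinarith [sq_nonneg (ρX (g • φ j) (φ (σ i g j)) - ρX (g • ψ j) (ψ (σ i g j)))]
  refine e3.trans_lt ?_
  nlinarith

variable [MeasurableSpace X] [Group Z] [IsTopologicalGroup Z] [CompactSpace Z]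
  [ContinuousConstSMul G Z] {π : X →* Z}

/-- Measure-theoretic microstates are topological microstates; only the pseudometrics have to be
exchanged, by `exists_separated_mul` with the trivial translation. -/
theorem measEntropyInPresence_le_topEntropyInPresence (hσ : IsSoficApproximation σ)
    (m : Measure X) (hπ : Continuous π) (hπG : ∀ (g : G) (x : X), π (g • x) = g • π x)
    (hX : IsDynGenPseudometric G ρX) (hX' : IsDynGenPseudometric G ρX')
    (hZ : IsDynGenPseudometric G ρZ) (hZ' : IsDynGenPseudometric G ρZ') :
    measEntropyInPresence σ m π ρZ' ρX' ≤ topEntropyInPresence σ π ρZ ρX := by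
  classical
  refine iSup₂_le fun ε hε => ?_
  obtain ⟨F₀, t, ht, hsep⟩ := exists_separated_mul hZ' hZ hε
  refine le_iSup₂_of_le t ht (le_iInf₂ fun F δ => le_iInf fun hδ => ?_)
  obtain ⟨F₁, δ₁, hδ₁, h₁⟩ := hσ.exists_topMap_comp hX' hX continuous_id (fun _ _ => rfl) F hδ
  obtain ⟨F₂, δ₂, hδ₂, h₂⟩ := hσ.exists_topMap_comp hX' hZ hπ hπG F₀ ht
  refine (iInf₂_le (F₁ ∪ F₂) ∅).trans ((iInf₂_le (min δ₁ δ₂) (lt_min hδ₁ hδ₂)).trans ?_)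
  have key := growthRate_le_add (A := fun i => (fun φ => π ∘ φ) ''
      measMap m ρX' (F₁ ∪ F₂) ∅ (min δ₁ δ₂) (σ i))
    (B := fun i => (fun φ => π ∘ φ) '' topMap ρX F δ (σ i)) (dist := ρZ') (dist' := ρZ) (ε := ε)
    (ε' := t) hσ.eventually_pos le_rfl ?_
  · simpa using key
  filter_upwards [h₁, h₂] with i hi₁ hi₂
  simp only [Real.exp_zero, ENNReal.ofReal_one, one_mul]
  have hmem : ∀ φ ∈ measMap m ρX' (F₁ ∪ F₂) ∅ (min δ₁ δ₂) (σ i),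
      φ ∈ topMap ρX F δ (σ i) ∧ π ∘ φ ∈ topMap ρZ F₀ t (σ i) := fun φ hφ =>
    ⟨hi₁ φ fun g hg => (hφ.1 g (Finset.mem_union_left _ hg)).trans_le (min_le_left _ _),
      hi₂ φ fun g hg => (hφ.1 g (Finset.mem_union_right _ hg)).trans_le (min_le_right _ _)⟩
  refine sepNumber_le_of_forall_finset fun S hS hSsep => card_le_sepNumber S (fun s hs => ?_)
    fun a ha b hb hab => ?_
  · obtain ⟨φ, hφ, rfl⟩ := hS hs
    exact ⟨φ, (hmem φ hφ).1, rfl⟩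
  · obtain ⟨φ, hφ, rfl⟩ := hS ha
    obtain ⟨φ', hφ', rfl⟩ := hS hb
    have := hsep _ (σ i) (π ∘ φ) (π ∘ φ') 1 (by simpa using (hmem φ hφ).2)
      (by simpa using (hmem φ' hφ').2) (hSsep _ ha _ hb hab)
    simpa using this

/-- Topological microstates can be translated, nearly all by the same random sample, to
measure-theoretic microstates without losing their separation. -/
theorem topEntropyInPresence_le_measEntropyInPresence [IsTopologicalGroup X]
    [TopologicalSpace.MetrizableSpace X] [BorelSpace X] (hσ : IsSoficApproximation σ)
    {m : Measure X} [IsProbabilityMeasure m] [m.IsMulLeftInvariant]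
    {μ : (i : ℕ) → Measure (Fin (d i) → X)} [∀ i, IsProbabilityMeasure (μ i)]
    {ρXX : X × X → X × X → ℝ} (hρXX : IsDynGenPseudometric G ρXX)
    (hμ : LocallyDoublyEmpiricallyConverges σ ρXX μ m)
    (hπ : Continuous π) (hπG : ∀ (g : G) (x : X), π (g • x) = g • π x)
    (hX : IsDynGenPseudometric G ρX) (hX' : IsDynGenPseudometric G ρX')
    (hZ : IsDynGenPseudometric G ρZ) (hZ' : IsDynGenPseudometric G ρZ') :
    topEntropyInPresence σ π ρZ ρX ≤ measEntropyInPresence σ m π ρZ' ρX' := by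
  classical
  refine iSup₂_le fun ε hε => ?_
  obtain ⟨F₀, t, ht, hsep⟩ := exists_separated_mul hZ hZ' hε
  refine le_iSup₂_of_le t ht (le_iInf₂ fun F L => le_iInf₂ fun δ hδ => ?_)
  obtain ⟨F₁, δ₁, hδ₁, h₁⟩ := hσ.exists_topMap_mul (π := id) continuous_id (fun _ _ => rfl)
    hX hX' F hδ
  obtain ⟨F₂, δ₂, hδ₂, h₂⟩ := hσ.exists_topMap_mul hπ hπG hX hZ' F₀ ht
  set F' := F₁ ∪ F₂ with hF'
  set δ' := min δ₁ δ₂ with hδ'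
  have hδ'0 : 0 < δ' := lt_min hδ₁ hδ₂
  refine (iInf₂_le F' δ').trans ((iInf_le _ hδ'0).trans ?_)
  refine le_of_forall_pos_le_add_coe fun κ hκ => growthRate_le_add hσ.eventually_pos hκ.le ?_
  -- The admissible probability of failure; a product `φ * ψ` may fail to be a microstate because
  -- of `ψ` itself or because of one of the functions in `L`.
  set η : ℝ := 1 - Real.exp (-κ) with hη
  have hη0 : 0 < η := by
    have : Real.exp (-κ) < 1 := (Real.exp_lt_exp.2 (neg_lt_zero.2 hκ)).trans_eq Real.exp_zero
    linarith
  set N : ℝ := L.card + 1 with hN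
  have hN0 : 0 < N := by positivity
  have hL : ∀ᶠ i in atTop, ∀ f ∈ L, ∀ φ : Fin (d i) → X,
      μ i {ψ | δ ≤ |(∫ x, f x ∂m) - (∑ j, f (φ j * ψ j)) / (d i : ℝ)|} ≤
        ENNReal.ofReal (η / N) :=
    (Filter.eventually_all_finset _).2 fun f _ =>
      hμ.eventually_average_mul hσ f hδ (by positivity)
  have htop := eventually_measure_compl_le
    (fun i => (isOpen_topMap hX F' δ' (σ i)).measurableSet)
    (hμ.tendsto_topMap hσ hρXX hX F' hδ'0) (div_pos hη0 hN0)
  filter_upwards [h₁, h₂, hL, htop] with i hi₁ hi₂ hiL hit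
  refine sepNumber_le_of_forall_finset fun S hS hSsep => ?_
  choose! φ hφ hφs using fun s (hs : s ∈ S) => hS hs
  -- `V (φ s) f` and `bad s` collect the samples `ψ` for which `φ s * ψ` is not good.
  let V : (Fin (d i) → X) → C(X, ℝ) → Set (Fin (d i) → X) := fun φ f =>
    {ψ | δ ≤ |(∫ x, f x ∂m) - (∑ j, f (φ j * ψ j)) / (d i : ℝ)|}
  have hVm : ∀ φ f, MeasurableSet (V φ f) := fun φ f => by
    refine (isClosed_le continuous_const (Continuous.abs (continuous_const.sub
      (Continuous.div_const (continuous_finsetSum _ fun j _ => ?_) _)))).measurableSet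
    fun_prop
  let bad : (Fin (d i) → Z) → Set (Fin (d i) → X) := fun s =>
    (topMap ρX F' δ' (σ i))ᶜ ∪ ⋃ f ∈ L, V (φ s) f
  have hbadm : ∀ s, MeasurableSet (bad s) := fun s =>
    ((isOpen_topMap hX F' δ' (σ i)).measurableSet.compl).union
      (Finset.measurableSet_biUnion _ fun f _ => hVm _ f)
  have hbad : ∀ s, μ i (bad s) ≤ ENNReal.ofReal η := fun s => by
    refine (measure_union_le _ _).trans ((add_le_add hit ((measure_biUnion_finset_le _ _).trans
      (Finset.sum_le_card_nsmul _ _ _ fun f hf => hiL f hf (φ s)))).trans_eq ?_)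
    rw [nsmul_eq_mul, ← ENNReal.ofReal_natCast, ← ENNReal.ofReal_mul (Nat.cast_nonneg _),
      ← ENNReal.ofReal_add (by positivity) (by positivity)]
    congr 1
    rw [hN]
    field_simp
    ring
  obtain ⟨ψ, T, hTS, hT, hcard⟩ := exists_card_filter_ge (μ i) S
    (fun s => (hbadm s).compl) hη0.le (fun s _ => by rw [compl_compl]; exact hbad s)
  have hgood : ∀ s ∈ T, φ s * ψ ∈ measMap m ρX' F L δ (σ i) ∧
      s * (π ∘ ψ) ∈ topMap ρZ' F₀ t (σ i) ∧ π ∘ (φ s * ψ) = s * (π ∘ ψ) := fun s hs => by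
    have hn : ψ ∉ bad s := hT s hs
    have hψ : ψ ∈ topMap ρX F' δ' (σ i) := by
      by_contra h
      exact hn (Or.inl h)
    have hφS := hφ s (hTS hs)
    have hsub₁ : topMap ρX F' δ' (σ i) ⊆ topMap ρX F₁ δ₁ (σ i) := fun χ hχ g hg =>
      (hχ g (Finset.mem_union_left _ hg)).trans_le (min_le_left _ _)
    have hsub₂ : topMap ρX F' δ' (σ i) ⊆ topMap ρX F₂ δ₂ (σ i) := fun χ hχ g hg =>
      (hχ g (Finset.mem_union_right _ hg)).trans_le (min_le_right _ _)
    have heq : π ∘ (φ s * ψ) = s * (π ∘ ψ) := by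
      funext j
      have := congrFun (hφs s (hTS hs)) j
      simp only [Function.comp_apply] at this
      simp [this]
    refine ⟨⟨hi₁ _ (hsub₁ hφS) _ (hsub₁ hψ), fun f hf => ?_⟩, ?_, heq⟩
    · by_contra! hc
      exact hn (Or.inr (Set.mem_biUnion hf hc))
    · rw [← heq]
      exact hi₂ _ (hsub₂ hφS) _ (hsub₂ hψ)
  have hTcard : (T.card : ENNReal) ≤ (sepNumber ((fun φ => π ∘ φ) ''
      measMap m ρX' F L δ (σ i)) (rho2 ρZ') t : ENNReal) := by
    rw [← Finset.card_image_of_injective T (mul_left_injective (π ∘ ψ))]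
    refine card_le_sepNumber _ (fun z hz => ?_) fun a ha b hb hab => ?_
    · obtain ⟨s, hs, rfl⟩ := Finset.mem_image.1 hz
      exact ⟨φ s * ψ, (hgood s hs).1, (hgood s hs).2.2⟩
    · obtain ⟨s, hs, rfl⟩ := Finset.mem_image.1 ha
      obtain ⟨s', hs', rfl⟩ := Finset.mem_image.1 hb
      exact hsep _ (σ i) s s' (π ∘ ψ) (hgood s hs).2.1 (hgood s' hs').2.1
        (hSsep s (hTS hs) s' (hTS hs') fun h => hab (by rw [h]))
  refine le_trans ?_ (mul_le_mul_right hTcard _)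
  rw [← ENNReal.ofReal_natCast, ← ENNReal.ofReal_natCast, ← ENNReal.ofReal_mul (Real.exp_pos _).le]
  refine ENNReal.ofReal_le_ofReal ?_
  have h3 : (1 - η) * S.card = Real.exp (-κ) * S.card := by rw [hη]; ring
  rw [h3] at hcard
  have h4 := mul_le_mul_of_nonneg_left hcard (Real.exp_pos κ).le
  rwa [← mul_assoc, ← Real.exp_add, add_neg_cancel, Real.exp_zero, one_mul] at h4

end Entropy

end SoficEntropy

theorem theorem1p1 {G X : Type*} [Group G] [Countable G]
    [Group X] [TopologicalSpace X] [IsTopologicalGroup X] [CompactSpace X]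
    [TopologicalSpace.MetrizableSpace X] [MeasurableSpace X] [BorelSpace X]
    [MulDistribMulAction G X] [ContinuousConstSMul G X]
    (m : Measure X) [IsProbabilityMeasure m] [m.IsHaarMeasure]
    {d : ℕ → ℕ} (σ : (i : ℕ) → G → Equiv.Perm (Fin (d i))) (hσ : IsSoficApproximation σ)
    (μ : (i : ℕ) → Measure (Fin (d i) → X)) [∀ i, IsProbabilityMeasure (μ i)]
    (ρXX : X × X → X × X → ℝ) (hρXX : IsDynGenPseudometric G ρXX)
    (hμ : LocallyDoublyEmpiricallyConverges σ ρXX μ m) :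
    (∀ (Y : Subgroup X) [Y.Normal] (_ : IsClosed (Y : Set X))
      (hYG : ∀ g : G, ∀ y ∈ Y, g • y ∈ Y),
      haveI : MulAction.QuotientAction G Y := quotientAction_of_invariant hYG
      ∀ (ρX ρX' : X → X → ℝ) (ρQ ρQ' : X ⧸ Y → X ⧸ Y → ℝ),
        IsDynGenPseudometric G ρX → IsDynGenPseudometric G ρX' →
        IsDynGenPseudometric G ρQ → IsDynGenPseudometric G ρQ' →
        topEntropyInPresence σ (fun x : X => (x : X ⧸ Y)) ρQ ρX =
          measEntropyInPresence σ m (fun x : X => (x : X ⧸ Y)) ρQ' ρX') ∧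
    (∀ ρ ρ' : X → X → ℝ, IsDynGenPseudometric G ρ → IsDynGenPseudometric G ρ' →
      topEntropy σ ρ = measEntropy σ m ρ') := by
  refine ⟨?_, fun ρ ρ' hρ hρ' => ?_⟩
  · intro Y _ _ hYG
    have : MulAction.QuotientAction G Y := quotientAction_of_invariant hYG
    have : ContinuousConstSMul G (X ⧸ Y) := ⟨fun g => by
      refine (QuotientGroup.isQuotientMap_mk (N := Y)).continuous_iff.2 ?_
      exact QuotientGroup.continuous_mk.comp (continuous_const_smul g)⟩
    intro ρX ρX' ρQ ρQ' hX hX' hQ hQ'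
    have hc : Continuous (QuotientGroup.mk' Y) := QuotientGroup.continuous_mk
    have hG : ∀ (g : G) (x : X), QuotientGroup.mk' Y (g • x) = g • QuotientGroup.mk' Y x :=
      fun _ _ => rfl
    change topEntropyInPresence σ (QuotientGroup.mk' Y) ρQ ρX =
      measEntropyInPresence σ m (QuotientGroup.mk' Y) ρQ' ρX'
    exact le_antisymm
      (topEntropyInPresence_le_measEntropyInPresence (π := QuotientGroup.mk' Y) hσ hρXX hμ hc hG
        hX hX' hQ hQ')
      (measEntropyInPresence_le_topEntropyInPresence (π := QuotientGroup.mk' Y) hσ m hc hG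
        hX hX' hQ hQ')
  · have hc : Continuous (MonoidHom.id X) := continuous_id
    have hG : ∀ (g : G) (x : X), MonoidHom.id X (g • x) = g • MonoidHom.id X x := fun _ _ => rfl
    change topEntropyInPresence σ (MonoidHom.id X) ρ ρ =
      measEntropyInPresence σ m (MonoidHom.id X) ρ' ρ'
    exact le_antisymm
      (topEntropyInPresence_le_measEntropyInPresence (π := MonoidHom.id X) hσ hρXX hμ hc hG
        hρ hρ' hρ hρ')
      (measEntropyInPresence_le_topEntropyInPresence (π := MonoidHom.id X) hσ m hc hG
        hρ hρ' hρ hρ')
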